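/- **Setting.** A symmetric two-player stage game has an interval $A\subseteq\mathbb R$ of actions and a continuous payoff $\pi(a,b)$ (own action $a$, opponent's action $b$) for which best replies $\max_{a'}\pi(a',b)$ exist; $(a^N,a^N)$ is a Nash equilibrium, and $a^*\neq a^N$ maximizes $\pi(a):=\pi(a,a)$ over $A$. Put $G(a)=\max_{a'}\pi(a',a)-\pi(a,a)$ and $L(a)=\pi(a,a)-\pi(a^N,a^N)$. If $a^N<a^*$, then $\pi(a)$ and $G(a)$ are strictly increasing on $A\cap[a^N,a^*]$, and $G$ is non-decreasing on $A\cap[a^*,\infty)$; if $a^N>a^*$, the mirror-image conditions hold (and all order conditions below are mirrored). In the revision game with horizon $T>0$, time is measured by the remaining length $t\in[0,T]$. The players choose actions simultaneously at $t=T$, and again at each arrival of a Poisson process of rate $\lambda>0$ (a common revision opportunity). The payoffs are those of the last chosen profile. Strategies depend measurably on the public history of past opportunities and chosen profiles, and on $t$. A profile is a subgame perfect equilibrium (SPE) if, after every history and at every opportunity $t\in[0,T]$, no player can raise the expected payoff in the remaining game by switching to another strategy (with well-defined finite expected payoff). Given a cooperative plan $x:[0,T]\to A$ (that is, $x(t)\ge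 a^N$ for all $t$) and $k\in(0,1)$, the Limited Retaliation (LR) strategy $\{x(\cdot),k\}$ plays $x(t)$ at an opportunity with remaining time $t$, unless $t$ lies in a retaliation phase, where it plays $a^N$. If outside a retaliation phase some player does not play $x(s)$ at an opportunity with remaining time $s$, a retaliation phase starts, which consists of the remaining times $t$ with $(1-k)s\le t<s$. Actions during a retaliation phase have no influence on the later play, which returns to $x$ when the phase ends. Let $\kappa=1-k$ and $\tau(n)=k\kappa^{n-1}T$ for $n\ge1$. Assume that $\pi(a)$ is non-decreasing on $A\cap[a^*,\infty)$, or else that $x(t)\le a^*$ for all $t$. **Theorem.** The profile in which both players use the LR strategy $\{x(\cdot),k\}$ is an SPE if there is a sequence $(a_n)_{n\ge1}$ in $A$ such that (1) $x$ is piecewise constant on the geometric slots: $x(t)=a_n$ whenever $-t\in(-\kappa^{n-1}T,-\kappa^nT]$, for every $n\ge1$; and at the two end points that the slots leave out, $x(T)=a_1$ and $x(0)=a^N$; (2) $G(a_n)e^{-\lambda\tau(n+1)}\le L(a_{n+1})\bigl(1-e^{-\lambda\tau(n+1)}\bigr)$ for every $n\ge1$; (3) for some $c\ge1$, $G(a_c)e^{-\lambda\tau(c)}\le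 L(a_c)\bigl(1-e^{-\lambda\tau(c)}\bigr)$. -/

import Mathlib

open MeasureTheory Set

noncomputable section

/-- A two-player symmetric stage game on an interval `A` of real actions.  `pay a b` is the payoff
of a player who uses `a` against an opponent who uses `b`.  `aN` is the symmetric Nash (defection)
action, `aStar` a maximizer of the symmetric payoff. -/
structure StageGame where
  A : Set ℝ
  convex_A : Convex ℝ A
  pay : A → A → ℝ
  continuous_pay : Continuous fun p : A × A => pay p.1 p.2
  aN : A
  aStar : A
  nash : ∀ a, pay a aN ≤ pay aN aN
  optimal : ∀ a, pay a a ≤ pay aStar aStar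
  /-- best replies exist, so that the maximum in the deviation gain makes sense -/
  exists_best_reply : ∀ b, ∃ a, ∀ a', pay a' b ≤ pay a b

namespace StageGame

variable (G : StageGame)

/-- Payoff at the symmetric profile `(a, a)`. -/
def symPay (a : G.A) : ℝ := G.pay a a

/-- Deviation gain `max_{a'} pay a' a - pay a a`. -/
def gain (a : G.A) : ℝ := sSup (range fun a' => G.pay a' a) - G.pay a a

/-- Retaliation loss. -/
def loss (a : G.A) : ℝ := G.pay a a - G.pay G.aN G.aN

/-- `b` lies weakly further than `a` in the direction that leads from `aN` to `aStar`:
this is `a ≤ b` if `aN < aStar`, and `b ≤ a` in the mirrored case `aStar < aN`. -/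
def Below (a b : G.A) : Prop :=
  (G.aN < G.aStar ∧ a ≤ b) ∨ (G.aStar < G.aN ∧ b ≤ a)

/-- Monotonicity of the symmetric payoff between `aN` and `aStar`, and of the deviation gain. -/
structure Regular : Prop where
  ne : G.aN ≠ G.aStar
  symPay_strict : ∀ a b, G.Below G.aN a → G.Below a b → G.Below b G.aStar → a ≠ b →
    G.symPay a < G.symPay b
  gain_strict : ∀ a b, G.Below G.aN a → G.Below a b → G.Below b G.aStar → a ≠ b →
    G.gain a < G.gain b
  gain_beyond : ∀ a b, G.Below G.aStar a → G.Below a b → G.gain a ≤ G.gain b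

/-- The symmetric payoff is non-decreasing beyond `aStar`. -/
def PayMonotoneBeyond : Prop :=
  ∀ a b, G.Below G.aStar a → G.Below a b → G.symPay a ≤ G.symPay b

/-! ### The revision game

Times are measured by the remaining length `t` until the deadline.  Players are `Bool`, the opponent
of `i` is `!i`. -/

/-- Action profiles. -/
abbrev Profile : Type := Bool → G.A

/-- A public history: the past revision opportunities (including the initial choice),
most recent first, with the profile chosen at each of them. -/
abbrev History : Type := List (ℝ × G.Profile)

/-- A strategy prescribes an action at a revision opportunity, given the history before it and
the remaining time. -/
abbrev Strategy : Type := G.History → ℝ → G.A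

variable {G}

/-- Measurability of a strategy, for each number of past opportunities. -/
def Strategy.IsMeasurable (s : G.Strategy) : Prop :=
  ∀ n : ℕ, Measurable fun p : (Fin n → ℝ × G.Profile) × ℝ => s (List.ofFn p.1) p.2

/-- The payoff of player `i` at an action profile. -/
def payoff (i : Bool) (p : G.Profile) : ℝ := G.pay (p i) (p !i)

/-- The profile in force at the deadline, if `σ` is played from the opportunity at `t` on, after
the history `h`, and if the later opportunities arrive at the listed remaining times. -/
def finalProfile (σ : Bool → G.Strategy) : G.History → ℝ → List ℝ → G.Profile
  | h, t, [] => fun i => σ i h t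
  | h, t, s :: l => finalProfile σ ((t, fun i => σ i h t) :: h) s l

end StageGame

/-- Possible `n`-tuples of arrivals in the remaining time after `t`, in chronological order. -/
def arrivalSet (t : ℝ) (n : ℕ) : Set (Fin n → ℝ) :=
  {s | StrictAnti s ∧ ∀ j, s j ∈ Ico 0 t}

/-- The law of the arrivals of a Poisson process of rate `lam` during a remaining time `t`: on
`n`-point configurations, listed in chronological order, it has density `e ^ (- lam t) lam ^ n`
(the number of arrivals is Poisson with mean `lam t`, and given this number the arrivals are the
ordered values of independent uniform points). -/
def arrivalLaw (lam t : ℝ) : Measure (Σ n : ℕ, (Fin n → ℝ)) :=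
  Measure.sum fun n : ℕ =>
    Measure.map (Sigma.mk n)
      (ENNReal.ofReal (Real.exp (-(lam * t)) * lam ^ n) • volume.restrict (arrivalSet t n))

namespace StageGame

variable {G : StageGame}

/-- The realized payoff of player `i` in the subgame after `h` that starts with the
opportunity at `t`, as a function of the later arrivals. -/
def realizedPayoff (σ : Bool → G.Strategy) (i : Bool) (h : G.History) (t : ℝ)
    (w : Σ n : ℕ, (Fin n → ℝ)) : ℝ :=
  payoff i (finalProfile σ h t (List.ofFn w.2))

/-- The expected payoff in that subgame. -/
def expectedPayoff (lam : ℝ) (σ : Bool → G.Strategy) (i : Bool) (h : G.History) (t : ℝ) : ℝ :=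
  ∫ w, realizedPayoff σ i h t w ∂(arrivalLaw lam t)

/-- `h` is a possible history before an opportunity at remaining time `t ∈ [0, T]`: the
opportunities are at distinct times in chronological order, and the first one is at `T`
(for empty `h`, the current one is the initial choice and `t = T`). -/
def IsNode (T : ℝ) (h : G.History) (t : ℝ) : Prop :=
  0 ≤ t ∧ (t :: h.map Prod.fst).Pairwise (· < ·) ∧ (t :: h.map Prod.fst).getLast? = some T

/-- Subgame perfect equilibrium: measurable strategies that have an expected payoff in
every subgame, and such that after no history any player gains by switching to another measurable
strategy (with an expected payoff) in the subgame. -/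
def IsSPE (lam T : ℝ) (σ : Bool → G.Strategy) : Prop :=
  (∀ i, (σ i).IsMeasurable) ∧
  ∀ (h : G.History) (t : ℝ), IsNode T h t → ∀ i : Bool,
    Integrable (realizedPayoff σ i h t) (arrivalLaw lam t) ∧
    ∀ s' : G.Strategy, s'.IsMeasurable →
      Integrable (realizedPayoff (Function.update σ i s') i h t) (arrivalLaw lam t) →
      expectedPayoff lam (Function.update σ i s') i h t ≤ expectedPayoff lam σ i h t

/-! ### Limited retaliation -/

/-- Whether the remaining time `t` (after the history) lies in a retaliation phase.
A deviation from the plan at remaining time `s`, outside retaliation, starts the phase of remaining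
times from `s` down to `(1 - k) * s`, and nothing that happens during a phase changes it. -/
def Retaliating (x : ℝ → G.A) (k : ℝ) : G.History → ℝ → Prop
  | [], _ => False
  | (s, p) :: h, t =>
      (Retaliating x k h s ∧ Retaliating x k h t) ∨
      (¬ Retaliating x k h s ∧ p ≠ (fun _ => x s) ∧ (1 - k) * s ≤ t)

open Classical in
/-- The limited retaliation strategy with plan `x` and retaliation coefficient `k`. -/
def lrStrategy (x : ℝ → G.A) (k : ℝ) : G.Strategy :=
  fun h t => if Retaliating x k h t then G.aN else x t

/-- Cooperative plans on `[0, T]`. -/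
structure IsCooperativePlan (T : ℝ) (x : ℝ → G.A) : Prop where
  measurable : Measurable x
  cooperative : ∀ t ∈ Icc 0 T, G.Below G.aN (x t)

/-- The plan `x` plays `a n` on the `n`-th slot, `n ≥ 1`, which is the set of remaining times
`t` with `κ ^ n * T ≤ t < κ ^ (n - 1) * T`, `κ = 1 - k`.  The slots leave out the two end points: the
initial choice is that of the first slot, and the defection action is used at the deadline. -/
structure IsPiecewisePlan (T k : ℝ) (a : ℕ → G.A) (x : ℝ → G.A) : Prop where
  slot : ∀ n : ℕ, 1 ≤ n → ∀ t ∈ Ico ((1 - k) ^ n * T) ((1 - k) ^ (n - 1) * T), x t = a n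
  initial : x T = a 1
  deadline : x 0 = G.aN

end StageGame

/-- Length of the `n`-th slot, `n ≥ 1`. -/
def slotLength (T k : ℝ) (n : ℕ) : ℝ := k * (1 - k) ^ (n - 1) * T

end

/-! Write `κ = 1 - k` and let `M` bound every payoff against an action of the plan. For each profile
consider the expected shortfall from `M`, multiplied by `e ^ (lam t)`. Conditioning on the next
arrival gives a renewal equation: the value at `t` is the shortfall now plus `lam` times the
integral over `s ∈ [0, t)` of the value at `s` after the extended history. Shortfalls are
nonnegative, so everything lives in `ENNReal`, although a deviator's payoff may be unbounded below.
Supersolutions bound the expected shortfall from above (`arrivalSum_le`), bounded subsolutions from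
below (`le_iSup_arrivalSum`). The explicit value `lrShortfall` solves the equation of the LR
profile; if no single deviation pays, it is a subsolution for every profile in which one player
switches. This is the one-shot principle `isSPE_lrStrategy_of_oneShot`.

A single deviation at `t` gains at most `gain (x t)` and costs `lam ∫ e ^ (lam (t - s)) loss (x s)
ds` over the window `[κ t, t)`, which straddles the current slot `n` and the next one. After a
change of variable the net cost is concave, so the two ends of the slot suffice
(`incentive_of_endpoints`). At the lower end the window is slot `n + 1`, and the constraint is `h2`.
At the upper end it is slot `n` itself: each action must be deterred by its own loss.
`gain_le_of_chain` derives this for every slot from the chain `h2`: an action violating it would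
keep all later actions weakly beyond it, with gains bounded away from zero, while the slots, and
with them the punishments, shrink to nothing. -/

noncomputable section

/-! ### Arrival configurations and their law -/

theorem measurable_sigmaMk (n : ℕ) :
    Measurable (Sigma.mk (β := fun n => Fin n → ℝ) n) :=
  fun _ hs => MeasurableSpace.measurableSet_iInf.1 hs n

theorem measurable_of_sigma {β : Type*} [MeasurableSpace β] {f : (Σ n : ℕ, (Fin n → ℝ)) → β}
    (hf : ∀ n, Measurable fun w : Fin n → ℝ => f ⟨n, w⟩) : Measurable f :=
  fun _ hs => MeasurableSpace.measurableSet_iInf.2 fun n => hf n hs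

theorem measurableSet_setOf_mem_arrivalSet (n : ℕ) :
    MeasurableSet {p : ℝ × (Fin n → ℝ) | p.2 ∈ arrivalSet p.1 n} := by
  have : {p : ℝ × (Fin n → ℝ) | p.2 ∈ arrivalSet p.1 n} =
      (⋂ i, ⋂ j, {p : ℝ × (Fin n → ℝ) | i < j → p.2 j < p.2 i}) ∩
        ⋂ j, {p : ℝ × (Fin n → ℝ) | 0 ≤ p.2 j ∧ p.2 j < p.1} := by
    ext p
    simp [arrivalSet, StrictAnti]
  rw [this]
  refine (MeasurableSet.iInter fun i => MeasurableSet.iInter fun j => ?_).inter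
    (MeasurableSet.iInter fun j => ?_)
  · by_cases hij : i < j
    · simp only [hij, true_imp_iff]
      exact measurableSet_lt ((measurable_pi_apply j).comp measurable_snd)
        ((measurable_pi_apply i).comp measurable_snd)
    · simp [hij]
  · have hj : Measurable fun p : ℝ × (Fin n → ℝ) => p.2 j :=
      (measurable_pi_apply j).comp measurable_snd
    exact (measurableSet_le measurable_const hj).inter (measurableSet_lt hj measurable_fst)

theorem measurableSet_arrivalSet (t : ℝ) (n : ℕ) : MeasurableSet (arrivalSet t n) :=
  (measurable_const.prodMk measurable_id : Measurable fun w : Fin n → ℝ => (t, w))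
    (measurableSet_setOf_mem_arrivalSet n)

theorem cons_mem_arrivalSet {t s : ℝ} {n : ℕ} {w : Fin n → ℝ} :
    (Fin.cons s w : Fin (n + 1) → ℝ) ∈ arrivalSet t (n + 1) ↔
      s ∈ Ico 0 t ∧ w ∈ arrivalSet s n := by
  constructor
  · rintro ⟨h1, h2⟩
    refine ⟨by simpa using h2 0, fun i j hij => ?_, fun j => ⟨?_, ?_⟩⟩
    · simpa using h1 (Fin.succ_lt_succ_iff.2 hij)
    · simpa using (h2 j.succ).1
    · simpa using h1 (Fin.succ_pos j)
  · rintro ⟨h1, h2, h3⟩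
    refine ⟨fun i j => ?_, fun j => ?_⟩
    · refine Fin.cases ?_ (fun i => ?_) i <;> refine Fin.cases ?_ (fun j => ?_) j
      · simp
      · intro _; simpa using (h3 j).2
      · simp
      · intro h; simpa using h2 (Fin.succ_lt_succ_iff.1 h)
    · refine Fin.cases ?_ (fun j => ?_) j
      · simpa using h1
      · simpa using And.intro (h3 j).1 ((h3 j).2.trans h1.2)

/-- The first arrival is split off. -/
theorem lintegral_arrivalSet_succ (t : ℝ) (n : ℕ) (f : (Fin (n + 1) → ℝ) → ENNReal)
    (hf : Measurable f) :
    ∫⁻ w in arrivalSet t (n + 1), f w =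
      ∫⁻ s in Ico 0 t, ∫⁻ w in arrivalSet s n, f (Fin.cons s w) := by
  rw [← lintegral_indicator (measurableSet_arrivalSet t _)]
  have hm : Measurable ((arrivalSet t (n + 1)).indicator f) :=
    hf.indicator (measurableSet_arrivalSet t _)
  have hmp := (volume_preserving_piFinSuccAbove (fun _ : Fin (n + 1) => ℝ) 0).symm
  rw [← hmp.lintegral_comp hm, Measure.volume_eq_prod,
    lintegral_prod (fun q => (arrivalSet t (n + 1)).indicator f
      ((MeasurableEquiv.piFinSuccAbove (fun _ : Fin (n + 1) => ℝ) 0).symm q))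
      (hm.comp hmp.measurable).aemeasurable, ← lintegral_indicator measurableSet_Ico]
  refine lintegral_congr fun s => ?_
  have key : ∀ w : Fin n → ℝ,
      (arrivalSet t (n + 1)).indicator f
        ((MeasurableEquiv.piFinSuccAbove (fun _ : Fin (n + 1) => ℝ) 0).symm (s, w)) =
      (Ico 0 t).indicator
        (fun s => (arrivalSet s n).indicator (fun w => f (Fin.cons s w)) w) s := by
    intro w
    have hc : (MeasurableEquiv.piFinSuccAbove (fun _ : Fin (n + 1) => ℝ) 0).symm (s, w) =
        (Fin.cons s w : Fin (n + 1) → ℝ) := by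
      ext j
      simp [MeasurableEquiv.piFinSuccAbove]
    rw [hc]
    by_cases h1 : s ∈ Ico 0 t <;> by_cases h2 : w ∈ arrivalSet s n <;>
      simp [indicator, cons_mem_arrivalSet, h1, h2, -mem_Ico]
  simp_rw [key]
  by_cases h1 : s ∈ Ico 0 t
  · simp only [indicator_of_mem h1]
    rw [lintegral_indicator (measurableSet_arrivalSet s n)]
  · simp [indicator_of_notMem h1]

theorem lintegral_arrivalLaw (lam t : ℝ) (f : (Σ n : ℕ, (Fin n → ℝ)) → ENNReal)
    (hf : Measurable f) :
    ∫⁻ w, f w ∂(arrivalLaw lam t) =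
      ∑' n : ℕ, ENNReal.ofReal (Real.exp (-(lam * t)) * lam ^ n) *
        ∫⁻ w in arrivalSet t n, f ⟨n, w⟩ := by
  rw [arrivalLaw, lintegral_sum_measure]
  refine tsum_congr fun n => ?_
  rw [lintegral_map hf (measurable_sigmaMk n), lintegral_smul_measure, smul_eq_mul]

theorem ae_arrivalLaw_mem (lam t : ℝ) :
    ∀ᵐ w ∂(arrivalLaw lam t), w.2 ∈ arrivalSet t w.1 := by
  rw [arrivalLaw, Measure.ae_sum_iff]
  intro n
  refine (ae_map_iff (measurable_sigmaMk n).aemeasurable ?_).2 ?_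
  · rw [MeasurableSpace.measurableSet_iInf]
    intro m
    exact measurableSet_arrivalSet t m
  · exact Measure.ae_smul_measure (ae_restrict_mem (measurableSet_arrivalSet t n)) _

/-! ### Poisson expansion of the expected payoff -/

namespace StageGame

variable {G : StageGame}

/-- Each arrival lengthens the history by one entry, so the induction on the number of arrivals
needs the history itself as a variable, of arbitrary length `m`. -/
theorem measurable_finalProfile {σ : Bool → G.Strategy} (hσ : ∀ i, (σ i).IsMeasurable)
    (n m : ℕ) :
    Measurable fun q : ((Fin m → ℝ × G.Profile) × ℝ) × (Fin n → ℝ) =>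
      finalProfile σ (List.ofFn q.1.1) q.1.2 (List.ofFn q.2) := by
  induction n generalizing m with
  | zero =>
    simp only [List.ofFn_zero, finalProfile]
    exact measurable_pi_lambda _ fun i => (hσ i m).comp measurable_fst
  | succ n ih =>
    have hact : Measurable fun q : ((Fin m → ℝ × G.Profile) × ℝ) × (Fin (n + 1) → ℝ) =>
        ((q.1.2, fun i => σ i (List.ofFn q.1.1) q.1.2) : ℝ × G.Profile) :=
      (measurable_snd.comp measurable_fst).prodMk
        (measurable_pi_lambda _ fun i => (hσ i m).comp measurable_fst)
    have hcons : Measurable fun q : ((Fin m → ℝ × G.Profile) × ℝ) × (Fin (n + 1) → ℝ) =>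
        (Fin.cons (q.1.2, fun i => σ i (List.ofFn q.1.1) q.1.2) q.1.1 :
          Fin (m + 1) → ℝ × G.Profile) := by
      refine measurable_pi_lambda _ fun j => ?_
      refine Fin.cases ?_ (fun j => ?_) j
      · simpa using hact
      · simp only [Fin.cons_succ]
        fun_prop
    have := (ih (m + 1)).comp ((hcons.prodMk
      ((measurable_pi_apply 0).comp measurable_snd)).prodMk
      (measurable_pi_lambda _ fun j => (measurable_pi_apply (Fin.succ j)).comp measurable_snd))
    convert this using 1
    funext q
    simp [List.ofFn_succ, finalProfile]

theorem measurable_finalProfile_of_history {σ : Bool → G.Strategy}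
    (hσ : ∀ i, (σ i).IsMeasurable) (h : G.History) (n : ℕ) :
    Measurable fun q : ℝ × (Fin n → ℝ) => finalProfile σ h q.1 (List.ofFn q.2) := by
  have := (measurable_finalProfile hσ n h.length).comp
    ((measurable_const.prodMk measurable_fst).prodMk measurable_snd :
      Measurable fun q : ℝ × (Fin n → ℝ) => ((h.get, q.1), q.2))
  simpa [Function.comp_def] using this

/-- The integral of `F` of the final profile over the configurations of `n` later arrivals. -/
def arrivalIntegral (σ : Bool → G.Strategy) (F : G.Profile → ENNReal) (n : ℕ) (h : G.History)
    (t : ℝ) : ENNReal :=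
  ∫⁻ w in arrivalSet t n, F (finalProfile σ h t (List.ofFn w))

theorem measurable_arrivalIntegral {σ : Bool → G.Strategy} (hσ : ∀ i, (σ i).IsMeasurable)
    {F : G.Profile → ENNReal} (hF : Measurable F) (n : ℕ) (h : G.History) :
    Measurable (arrivalIntegral σ F n h) := by
  have h1 : Measurable ({p : ℝ × (Fin n → ℝ) | p.2 ∈ arrivalSet p.1 n}.indicator
      fun q : ℝ × (Fin n → ℝ) => F (finalProfile σ h q.1 (List.ofFn q.2))) :=
    (hF.comp (measurable_finalProfile_of_history hσ h n)).indicator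
      (measurableSet_setOf_mem_arrivalSet n)
  convert h1.lintegral_prod_right' (ν := volume) using 1
  funext t
  rw [arrivalIntegral, ← lintegral_indicator (measurableSet_arrivalSet t n)]
  rfl

theorem arrivalIntegral_zero (σ : Bool → G.Strategy) (F : G.Profile → ENNReal) (h : G.History)
    (t : ℝ) : arrivalIntegral σ F 0 h t = F (fun i => σ i h t) := by
  have : arrivalSet t 0 = univ :=
    eq_univ_of_forall fun w => ⟨fun i => i.elim0, fun i => i.elim0⟩
  simp [arrivalIntegral, this, finalProfile, volume_pi]

theorem arrivalIntegral_succ {σ : Bool → G.Strategy} (hσ : ∀ i, (σ i).IsMeasurable)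
    {F : G.Profile → ENNReal} (hF : Measurable F) (n : ℕ) (h : G.History) (t : ℝ) :
    arrivalIntegral σ F (n + 1) h t =
      ∫⁻ s in Ico 0 t, arrivalIntegral σ F n ((t, fun i => σ i h t) :: h) s := by
  rw [arrivalIntegral, lintegral_arrivalSet_succ]
  · simp [arrivalIntegral, List.ofFn_succ, finalProfile]
  · exact hF.comp ((measurable_finalProfile_of_history hσ h (n + 1)).comp
      (measurable_const.prodMk measurable_id))

/-- Partial sums of the Poisson expansion, without the factor `e ^ (- lam t)`. -/
def arrivalSum (lam : ℝ) (σ : Bool → G.Strategy) (F : G.Profile → ENNReal) (N : ℕ)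
    (h : G.History) (t : ℝ) : ENNReal :=
  ∑ n ∈ Finset.range N, ENNReal.ofReal lam ^ n * arrivalIntegral σ F n h t

theorem arrivalSum_succ (lam : ℝ) {σ : Bool → G.Strategy} (hσ : ∀ i, (σ i).IsMeasurable)
    {F : G.Profile → ENNReal} (hF : Measurable F) (N : ℕ) (h : G.History) (t : ℝ) :
    arrivalSum lam σ F (N + 1) h t = F (fun i => σ i h t) +
      ENNReal.ofReal lam * ∫⁻ s in Ico 0 t,
        arrivalSum lam σ F N ((t, fun i => σ i h t) :: h) s := by
  simp only [arrivalSum]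
  rw [Finset.sum_range_succ', add_comm, lintegral_finsetSum]
  · rw [Finset.mul_sum, arrivalIntegral_zero, pow_zero, one_mul]
    congr 1
    refine Finset.sum_congr rfl fun n _ => ?_
    rw [arrivalIntegral_succ hσ hF, lintegral_const_mul _ (measurable_arrivalIntegral hσ hF n _),
      pow_succ', mul_assoc]
  · exact fun n _ => (measurable_arrivalIntegral hσ hF n _).const_mul _

theorem measurable_finalProfile_arrivals {σ : Bool → G.Strategy}
    (hσ : ∀ i, (σ i).IsMeasurable) (h : G.History) (t : ℝ) :
    Measurable fun w : Σ n : ℕ, (Fin n → ℝ) => finalProfile σ h t (List.ofFn w.2) :=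
  measurable_of_sigma fun n => (measurable_finalProfile_of_history hσ h n).comp
    (measurable_const.prodMk measurable_id)

/-- The expectation in terms of the Poisson expansion. -/
theorem lintegral_finalProfile {lam : ℝ} (hlam : 0 ≤ lam) {σ : Bool → G.Strategy}
    (hσ : ∀ i, (σ i).IsMeasurable) {F : G.Profile → ENNReal} (hF : Measurable F)
    (h : G.History) (t : ℝ) :
    ∫⁻ w, F (finalProfile σ h t (List.ofFn w.2)) ∂(arrivalLaw lam t) =
      ENNReal.ofReal (Real.exp (-(lam * t))) * ⨆ N, arrivalSum lam σ F N h t := by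
  rw [lintegral_arrivalLaw _ _ (fun w => F (finalProfile σ h t (List.ofFn w.2)))
    (hF.comp (measurable_finalProfile_arrivals hσ h t))]
  simp only [arrivalSum]
  rw [← ENNReal.tsum_eq_iSup_nat, ← ENNReal.tsum_mul_left]
  refine tsum_congr fun n => ?_
  rw [ENNReal.ofReal_mul (Real.exp_nonneg _), ENNReal.ofReal_pow hlam, mul_assoc]
  rfl

/-! ### Comparison principles for the renewal equation -/

theorem IsNode.cons {T t s : ℝ} {h : G.History} (hn : IsNode T h t) (hs : s ∈ Ico 0 t)
    (p : G.Profile) : IsNode T ((t, p) :: h) s := by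
  obtain ⟨h0, h1, h2⟩ := hn
  refine ⟨hs.1, ?_, ?_⟩
  · simp only [List.map_cons]
    refine List.pairwise_cons.2 ⟨fun r hr => ?_, h1⟩
    rcases List.mem_cons.1 hr with rfl | hr
    · exact hs.2
    · exact hs.2.trans ((List.pairwise_cons.1 h1).1 r hr)
  · simpa [List.getLast?_cons_cons] using h2

theorem IsNode.le {T t : ℝ} {h : G.History} (hn : IsNode T h t) : t ≤ T := by
  obtain ⟨-, h1, h2⟩ := hn
  have := List.mem_of_getLast? h2
  rcases List.mem_cons.1 this with rfl | hr
  · exact le_rfl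
  · exact ((List.pairwise_cons.1 h1).1 T hr).le

/-- A supersolution of the renewal equation bounds the Poisson expansion. -/
theorem arrivalSum_le {lam T : ℝ} {σ : Bool → G.Strategy} (hσ : ∀ i, (σ i).IsMeasurable)
    {F : G.Profile → ENNReal} (hF : Measurable F) (v : G.History → ℝ → ENNReal)
    (hv : ∀ h t, IsNode T h t → F (fun i => σ i h t) +
      ENNReal.ofReal lam * ∫⁻ s in Ico 0 t, v ((t, fun i => σ i h t) :: h) s ≤ v h t)
    (N : ℕ) (h : G.History) (t : ℝ) (hn : IsNode T h t) : arrivalSum lam σ F N h t ≤ v h t := by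
  induction N generalizing h t with
  | zero => simp [arrivalSum]
  | succ N ih =>
    rw [arrivalSum_succ lam hσ hF]
    refine le_trans ?_ (hv h t hn)
    gcongr 2
    exact setLIntegral_mono' measurableSet_Ico fun s hs => ih _ _ (hn.cons hs _)

theorem lintegral_Ico_pow {t : ℝ} (ht : 0 ≤ t) (N : ℕ) :
    ∫⁻ s in Ico 0 t, ENNReal.ofReal (s ^ N) = ENNReal.ofReal (t ^ (N + 1) / (N + 1)) := by
  rw [← ofReal_integral_eq_lintegral_ofReal, integral_Ico_eq_integral_Ioc,
    ← intervalIntegral.integral_of_le ht, integral_pow]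
  · simp
  · exact (continuous_pow N).integrableOn_Icc.mono_set Ico_subset_Icc_self
  · exact (ae_restrict_mem measurableSet_Ico).mono fun s hs => pow_nonneg hs.1 N

/-- A bounded subsolution of the renewal equation is bounded by the Poisson expansion. -/
theorem le_iSup_arrivalSum {lam T : ℝ} (hlam : 0 ≤ lam) {σ : Bool → G.Strategy}
    (hσ : ∀ i, (σ i).IsMeasurable)
    {F : G.Profile → ENNReal} (hF : Measurable F) (v : G.History → ℝ → ENNReal)
    (hv : ∀ h t, IsNode T h t → v h t ≤ F (fun i => σ i h t) +
      ENNReal.ofReal lam * ∫⁻ s in Ico 0 t, v ((t, fun i => σ i h t) :: h) s)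
    {D : ℝ} (hD : 0 ≤ D) (hvD : ∀ h t, IsNode T h t → v h t ≤ ENNReal.ofReal D)
    (h : G.History) (t : ℝ) (hn : IsNode T h t) : v h t ≤ ⨆ N, arrivalSum lam σ F N h t := by
  -- Iterating the inequality `N` times leaves a remainder in which `v` is replaced by `D`; its
  -- `N`-fold ordered integral is `D (lam t) ^ N / N!`.
  have key : ∀ N : ℕ, ∀ h t, IsNode T h t →
      v h t ≤ arrivalSum lam σ F N h t +
        ENNReal.ofReal (D * lam ^ N / N.factorial) * ENNReal.ofReal (t ^ N) := by
    intro N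
    induction N with
    | zero => intro h t hn; simpa [arrivalSum] using hvD h t hn
    | succ N ih =>
      intro h t hn
      refine (hv h t hn).trans ?_
      rw [arrivalSum_succ lam hσ hF, add_assoc]
      gcongr 1
      have : ∫⁻ s in Ico 0 t, v ((t, fun i => σ i h t) :: h) s ≤
          (∫⁻ s in Ico 0 t, arrivalSum lam σ F N ((t, fun i => σ i h t) :: h) s) +
          ENNReal.ofReal (D * lam ^ N / N.factorial) * ENNReal.ofReal (t ^ (N + 1) / (N + 1)) := by
        rw [← lintegral_Ico_pow hn.1, ← lintegral_const_mul _ (by fun_prop),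
          ← lintegral_add_right _ (by fun_prop)]
        exact setLIntegral_mono' measurableSet_Ico fun s hs => ih _ _ (hn.cons hs _)
      refine (mul_le_mul_right this _).trans ?_
      rw [mul_add]
      gcongr 1
      have h0 := hn.1
      rw [← ENNReal.ofReal_mul (by positivity), ← ENNReal.ofReal_mul hlam,
        ← ENNReal.ofReal_mul (by positivity)]
      apply ENNReal.ofReal_le_ofReal
      rw [Nat.factorial_succ]
      push_cast
      apply le_of_eq
      field_simp
      ring
  have hlim : Filter.Tendsto (fun N : ℕ => (⨆ N, arrivalSum lam σ F N h t) +
      ENNReal.ofReal (D * lam ^ N / N.factorial) * ENNReal.ofReal (t ^ N)) Filter.atTop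
      (nhds ((⨆ N, arrivalSum lam σ F N h t) + 0)) := by
    refine tendsto_const_nhds.add ?_
    have h1 := (FloorSemiring.tendsto_pow_div_factorial_atTop (lam * t)).const_mul D
    have h2 := ENNReal.tendsto_ofReal h1
    rw [mul_zero, ENNReal.ofReal_zero] at h2
    refine h2.congr fun N => ?_
    rw [← ENNReal.ofReal_mul (by positivity)]
    congr 1
    ring
  rw [add_zero] at hlim
  exact ge_of_tendsto' hlim fun N => (key N h t hn).trans
    (by gcongr; exact le_iSup (fun N => arrivalSum lam σ F N h t) N)

end StageGame

/-! ### Explicit solution of the renewal equation -/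

/-- The solution of the renewal equation `v t = m t + lam * ∫ v` over `[0, t)`. -/
def renewalValue (lam : ℝ) (m : ℝ → ENNReal) (t : ℝ) : ENNReal :=
  m t + ENNReal.ofReal lam * ∫⁻ s in Ico 0 t, ENNReal.ofReal (Real.exp (lam * (t - s))) * m s

theorem lintegral_Ico_exp {c : ℝ} (hc : c ≠ 0) {a b : ℝ} (hab : a ≤ b) (r : ℝ) :
    ∫⁻ s in Ico a b, ENNReal.ofReal (Real.exp (c * (s - r))) =
      ENNReal.ofReal ((Real.exp (c * (b - r)) - Real.exp (c * (a - r))) / c) := by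
  have hcont : Continuous fun s : ℝ => Real.exp (c * (s - r)) := by fun_prop
  rw [← ofReal_integral_eq_lintegral_ofReal, integral_Ico_eq_integral_Ioc,
    ← intervalIntegral.integral_of_le hab,
    intervalIntegral.integral_eq_sub_of_hasDerivAt (f := fun s => Real.exp (c * (s - r)) / c)]
  · rw [sub_div]
  · intro s _
    have h1 : HasDerivAt (fun s : ℝ => c * (s - r)) c s := by
      simpa using ((hasDerivAt_id s).sub_const r).const_mul c
    simpa only [mul_div_cancel_right₀ _ hc] using h1.exp.div_const c
  · exact hcont.intervalIntegrable _ _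
  · exact hcont.integrableOn_Icc.mono_set Ico_subset_Icc_self
  · exact Filter.Eventually.of_forall fun s => (Real.exp_pos _).le

theorem lintegral_Ico_exp_sub {lam : ℝ} (hlam : 0 < lam) {a b : ℝ} (hab : a ≤ b) (t : ℝ) :
    ENNReal.ofReal lam * ∫⁻ s in Ico a b, ENNReal.ofReal (Real.exp (lam * (t - s))) =
      ENNReal.ofReal (Real.exp (lam * (t - a)) - Real.exp (lam * (t - b))) := by
  have h : ∀ s, lam * (t - s) = -lam * (s - t) := fun s => by ring
  simp only [h]
  rw [lintegral_Ico_exp (neg_ne_zero.2 hlam.ne') hab, ← ENNReal.ofReal_mul hlam.le]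
  congr 1
  field_simp
  ring

theorem renewalValue_congr {lam : ℝ} {m m' : ℝ → ENNReal} {t : ℝ} (ht : 0 ≤ t)
    (h : ∀ s ∈ Icc 0 t, m s = m' s) : renewalValue lam m t = renewalValue lam m' t := by
  rw [renewalValue, renewalValue, h t ⟨ht, le_rfl⟩]
  congr 2
  exact setLIntegral_congr_fun measurableSet_Ico fun s hs => by
    simp only [h s ⟨hs.1, hs.2.le⟩]

/-- This is what makes `renewalValue` a solution. By Tonelli the shortfall at `r` receives the total
weight `1 + lam ∫ e ^ (lam (s - r)) ds` over `s ∈ (r, t)`, which is `e ^ (lam (t - r))`. -/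
theorem lintegral_renewalValue {lam : ℝ} (hlam : 0 < lam) {m : ℝ → ENNReal} (hm : Measurable m)
    (t : ℝ) :
    ∫⁻ s in Ico 0 t, renewalValue lam m s =
      ∫⁻ s in Ico 0 t, ENNReal.ofReal (Real.exp (lam * (t - s))) * m s := by
  have hk : Measurable fun q : ℝ × ℝ => {q : ℝ × ℝ | q.2 < q.1}.indicator
      (fun q => ENNReal.ofReal (Real.exp (lam * (q.1 - q.2))) * m q.2) q :=
    Measurable.indicator (by fun_prop) (measurableSet_lt measurable_snd measurable_fst)
  have hinner : ∀ s ∈ Ico 0 t,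
      ∫⁻ r in Ico 0 s, ENNReal.ofReal (Real.exp (lam * (s - r))) * m r =
      ∫⁻ r in Ico 0 t, {q : ℝ × ℝ | q.2 < q.1}.indicator
        (fun q => ENNReal.ofReal (Real.exp (lam * (q.1 - q.2))) * m q.2) (s, r) := by
    intro s hs
    rw [← lintegral_indicator measurableSet_Ico, ← lintegral_indicator measurableSet_Ico]
    refine lintegral_congr fun r => ?_
    by_cases h1 : r < s
    · have h2 : r < t := h1.trans hs.2
      by_cases h0 : 0 ≤ r <;> simp [indicator, h0, h1, h2]
    · simp [indicator, h1]
  have houter : ∀ r ∈ Ico 0 t,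
      m r + ENNReal.ofReal lam * ∫⁻ s in Ico 0 t, {q : ℝ × ℝ | q.2 < q.1}.indicator
        (fun q => ENNReal.ofReal (Real.exp (lam * (q.1 - q.2))) * m q.2) (s, r) =
      ENNReal.ofReal (Real.exp (lam * (t - r))) * m r := by
    intro r hr
    have h1 : ∫⁻ s in Ico 0 t, {q : ℝ × ℝ | q.2 < q.1}.indicator
        (fun q => ENNReal.ofReal (Real.exp (lam * (q.1 - q.2))) * m q.2) (s, r) =
        ∫⁻ s in Ioo r t, ENNReal.ofReal (Real.exp (lam * (s - r))) * m r := by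
      rw [← lintegral_indicator measurableSet_Ico, ← lintegral_indicator measurableSet_Ioo]
      refine lintegral_congr fun s => ?_
      by_cases h1 : r < s
      · have h2 : 0 ≤ s := hr.1.trans h1.le
        by_cases h0 : s < t <;> simp [indicator, h0, h1, h2]
      · simp [indicator, h1]
    rw [h1, setLIntegral_congr Ioo_ae_eq_Ico, lintegral_mul_const _ (by fun_prop),
      lintegral_Ico_exp hlam.ne' hr.2.le, ← mul_assoc, ← ENNReal.ofReal_mul hlam.le,
      mul_div_cancel₀ _ hlam.ne', sub_self, mul_zero, Real.exp_zero]
    nth_rewrite 1 [← one_mul (m r)]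
    rw [← add_mul]
    congr 1
    rw [← ENNReal.ofReal_one, ← ENNReal.ofReal_add zero_le_one, add_sub_cancel]
    exact sub_nonneg.2 (Real.one_le_exp (mul_nonneg hlam.le (sub_nonneg.2 hr.2.le)))
  simp only [renewalValue]
  rw [lintegral_add_left hm]
  have h1 : ∫⁻ s in Ico 0 t, ENNReal.ofReal lam *
      ∫⁻ r in Ico 0 s, ENNReal.ofReal (Real.exp (lam * (s - r))) * m r =
      ∫⁻ r in Ico 0 t, ENNReal.ofReal lam * ∫⁻ s in Ico 0 t,
        {q : ℝ × ℝ | q.2 < q.1}.indicator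
        (fun q => ENNReal.ofReal (Real.exp (lam * (q.1 - q.2))) * m q.2) (s, r) := by
    rw [lintegral_const_mul' _ _ ENNReal.ofReal_ne_top,
      lintegral_const_mul' _ _ ENNReal.ofReal_ne_top,
      setLIntegral_congr_fun measurableSet_Ico hinner,
      lintegral_lintegral_swap hk.aemeasurable]
  rw [h1, ← lintegral_add_left hm]
  exact setLIntegral_congr_fun measurableSet_Ico houter

theorem renewalValue_le {lam T C : ℝ} (hlam : 0 ≤ lam) (hC : 0 ≤ C) (hT : 0 ≤ T)
    {m : ℝ → ENNReal} {t : ℝ} (ht : t ∈ Icc 0 T) (hm : ∀ s ∈ Icc 0 t, m s ≤ ENNReal.ofReal C) :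
    renewalValue lam m t ≤ ENNReal.ofReal (C + lam * (Real.exp (lam * T) * C * T)) := by
  rw [ENNReal.ofReal_add hC (by positivity), ENNReal.ofReal_mul hlam, renewalValue]
  gcongr 1
  · exact hm t ⟨ht.1, le_rfl⟩
  gcongr 1
  calc ∫⁻ s in Ico 0 t, ENNReal.ofReal (Real.exp (lam * (t - s))) * m s
      ≤ ∫⁻ s in Ico 0 t, ENNReal.ofReal (Real.exp (lam * T) * C) := by
        refine setLIntegral_mono' measurableSet_Ico fun s hs => ?_
        rw [ENNReal.ofReal_mul (Real.exp_nonneg _)]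
        gcongr
        · linarith [hs.1, ht.2]
        · exact hm s ⟨hs.1, hs.2.le⟩
    _ = ENNReal.ofReal (Real.exp (lam * T) * C * t) := by
        rw [setLIntegral_const, Real.volume_Ico, sub_zero, ← ENNReal.ofReal_mul (by positivity)]
    _ ≤ _ := by
        gcongr
        exact ht.2

/-! ### Limited retaliation and the one-shot deviation principle -/

namespace StageGame

variable {G : StageGame}

theorem continuous_symPay : Continuous G.symPay :=
  G.continuous_pay.comp (continuous_id.prodMk continuous_id)

theorem measurable_symPay : Measurable G.symPay := continuous_symPay.measurable

theorem measurable_payoff (i : Bool) : Measurable (payoff (G := G) i) :=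
  G.continuous_pay.measurable.comp (f := fun p : G.Profile => (p i, p !i))
    ((measurable_pi_apply i).prodMk (measurable_pi_apply (!i)))

/-- Given the history, a phase is a lower bound on the remaining time. Hence, outside a phase now,
no phase can begin later without a new deviation. -/
theorem Retaliating.mono {x : ℝ → G.A} {k : ℝ} {h : G.History} {s t : ℝ}
    (hr : Retaliating x k h s) (hst : s ≤ t) : Retaliating x k h t := by
  induction h generalizing s t with
  | nil => exact hr
  | cons q h ih =>
    obtain ⟨r, p⟩ := q
    rcases hr with ⟨h1, h2⟩ | ⟨h1, h2, h3⟩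
    · exact Or.inl ⟨h1, ih h2 hst⟩
    · exact Or.inr ⟨h1, h2, h3.trans hst⟩

theorem measurableSet_retaliating {x : ℝ → G.A} (hx : Measurable x) (k : ℝ) (n : ℕ) :
    MeasurableSet {q : (Fin n → ℝ × G.Profile) × ℝ | Retaliating x k (List.ofFn q.1) q.2} := by
  induction n with
  | zero => simp [Retaliating]
  | succ n ih =>
    have h0 : Measurable fun q : (Fin (n + 1) → ℝ × G.Profile) × ℝ => q.1 0 :=
      (measurable_pi_apply 0).comp measurable_fst
    have htail : Measurable fun q : (Fin (n + 1) → ℝ × G.Profile) × ℝ => fun j : Fin n =>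
        q.1 j.succ :=
      measurable_pi_lambda _ fun j => (measurable_pi_apply j.succ).comp measurable_fst
    have hs := (htail.prodMk (measurable_fst.comp h0)) ih
    have ht := (htail.prodMk measurable_snd) ih
    have hp : MeasurableSet {q : (Fin (n + 1) → ℝ × G.Profile) × ℝ |
        (q.1 0).2 = fun _ => x (q.1 0).1} :=
      measurableSet_eq_fun (measurable_snd.comp h0)
        (measurable_pi_lambda _ fun _ => hx.comp (measurable_fst.comp h0))
    have hk : MeasurableSet {q : (Fin (n + 1) → ℝ × G.Profile) × ℝ |
        (1 - k) * (q.1 0).1 ≤ q.2} :=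
      measurableSet_le ((measurable_fst.comp h0).const_mul _) measurable_snd
    convert (hs.inter ht).union (hs.compl.inter (hp.compl.inter hk)) using 1
    ext q
    simp only [List.ofFn_succ, mem_ofPred_eq]
    rfl

theorem isMeasurable_lrStrategy {x : ℝ → G.A} (hx : Measurable x) (k : ℝ) :
    (lrStrategy x k).IsMeasurable := fun n =>
  Measurable.ite (measurableSet_retaliating hx k n) measurable_const (hx.comp measurable_snd)

theorem measurable_lrStrategy_of_history {x : ℝ → G.A} (hx : Measurable x) (k : ℝ)
    (h : G.History) : Measurable (lrStrategy x k h) := by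
  have := (isMeasurable_lrStrategy hx k h.length).comp
    (measurable_const.prodMk measurable_id : Measurable fun t : ℝ => (h.get, t))
  simpa [Function.comp_def] using this

theorem retaliating_cons_iff_of_retaliating {x : ℝ → G.A} {k : ℝ} {h : G.History} {t : ℝ}
    (hr : Retaliating x k h t) (p : G.Profile) (s : ℝ) :
    Retaliating x k ((t, p) :: h) s ↔ Retaliating x k h s := by
  simp [Retaliating, hr]

theorem retaliating_cons_iff_of_not {x : ℝ → G.A} {k : ℝ} {h : G.History} {t : ℝ}
    (hr : ¬ Retaliating x k h t) (p : G.Profile) (s : ℝ) :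
    Retaliating x k ((t, p) :: h) s ↔ p ≠ (fun _ => x t) ∧ (1 - k) * t ≤ s := by
  simp [Retaliating, hr]

/-- Play inside a phase, or according to the plan outside it, leaves no trace in the later
behaviour. The value after such an opportunity can therefore be computed with the old history. -/
theorem lrStrategy_cons_of_conform {x : ℝ → G.A} {k : ℝ} {h : G.History} {s t : ℝ}
    {p : G.Profile} (hp : Retaliating x k h t ∨ p = fun _ => x t) (hst : s ≤ t) :
    lrStrategy x k ((t, p) :: h) s = lrStrategy x k h s := by
  by_cases hr : Retaliating x k h t
  · have h1 := retaliating_cons_iff_of_retaliating hr p s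
    by_cases h2 : Retaliating x k h s <;> simp [lrStrategy, h1, h2]
  · have h1 : ¬ Retaliating x k h s := fun h => hr (h.mono hst)
    have h2 : p = fun _ => x t := hp.resolve_left hr
    simp [lrStrategy, retaliating_cons_iff_of_not hr, h1, h2]

theorem lrStrategy_eq (x : ℝ → G.A) (k : ℝ) (h : G.History) (t : ℝ) :
    lrStrategy x k h t = G.aN ∨ lrStrategy x k h t = x t := by
  unfold lrStrategy
  split_ifs
  · exact Or.inl rfl
  · exact Or.inr rfl

/-- Expected shortfall from `M`, up to the factor `e ^ (- lam t)`, when both players follow the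
limited retaliation strategy. -/
def lrShortfall (lam M : ℝ) (x : ℝ → G.A) (k : ℝ) (h : G.History) : ℝ → ENNReal :=
  renewalValue lam fun s => ENNReal.ofReal (M - G.symPay (lrStrategy x k h s))

theorem measurable_stageShortfall {x : ℝ → G.A} (hx : Measurable x) (M k : ℝ) (h : G.History) :
    Measurable fun s => ENNReal.ofReal (M - G.symPay (lrStrategy x k h s)) :=
  ((measurable_symPay.comp (measurable_lrStrategy_of_history hx k h)).const_sub M).ennreal_ofReal

theorem lrShortfall_cons_of_conform {lam M : ℝ} {x : ℝ → G.A} {k : ℝ} {h : G.History} {s t : ℝ}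
    {p : G.Profile} (hp : Retaliating x k h t ∨ p = fun _ => x t) (hs : s ∈ Ico 0 t) :
    lrShortfall lam M x k ((t, p) :: h) s = lrShortfall lam M x k h s :=
  renewalValue_congr hs.1 fun r hr => by
    simp only [lrStrategy_cons_of_conform hp (hr.2.trans hs.2.le)]

theorem lrShortfall_eq {lam : ℝ} (hlam : 0 < lam) {x : ℝ → G.A} (hx : Measurable x) (M k : ℝ)
    (h : G.History) (t : ℝ) :
    lrShortfall lam M x k h t = ENNReal.ofReal (M - G.symPay (lrStrategy x k h t)) +
      ENNReal.ofReal lam * ∫⁻ s in Ico 0 t, lrShortfall lam M x k h s := by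
  unfold lrShortfall
  rw [lintegral_renewalValue hlam (measurable_stageShortfall hx M k h), renewalValue]

theorem lrShortfall_conform {lam : ℝ} (hlam : 0 < lam) {x : ℝ → G.A} (hx : Measurable x)
    (M k : ℝ) (h : G.History) (t : ℝ) :
    ENNReal.ofReal (M - G.symPay (lrStrategy x k h t)) + ENNReal.ofReal lam *
      ∫⁻ s in Ico 0 t, lrShortfall lam M x k ((t, fun _ => lrStrategy x k h t) :: h) s =
      lrShortfall lam M x k h t := by
  rw [lrShortfall_eq hlam hx]
  congr 2
  refine setLIntegral_congr_fun measurableSet_Ico fun s hs => lrShortfall_cons_of_conform ?_ hs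
  by_cases hr : Retaliating x k h t
  · exact Or.inl hr
  · simp [lrStrategy, hr]

/-- If no deviation from the plan pays when it is followed by the retaliation phase, then no
deviation at a single opportunity pays after any history. -/
theorem lrShortfall_le_of_deviation {lam T M k : ℝ} (hlam : 0 < lam)
    (hk : k ∈ Ioo (0 : ℝ) 1)
    {x : ℝ → G.A} (hx : Measurable x)
    (hM : ∀ t ∈ Icc 0 T, G.symPay (x t) ≤ M) (hL : ∀ t ∈ Icc 0 T, 0 ≤ G.loss (x t))
    (hIC : ∀ t ∈ Icc 0 T, ∀ b, ENNReal.ofReal (M - G.symPay (x t)) ≤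
      ENNReal.ofReal (M - G.pay b (x t)) + ENNReal.ofReal lam *
        ∫⁻ s in Ico ((1 - k) * t) t,
          ENNReal.ofReal (Real.exp (lam * (t - s))) * ENNReal.ofReal (G.loss (x s)))
    {h : G.History} {t : ℝ} (ht : t ∈ Icc 0 T) {i : Bool} {p : G.Profile}
    (hp : p (!i) = lrStrategy x k h t) :
    lrShortfall lam M x k h t ≤ ENNReal.ofReal (M - payoff i p) +
      ENNReal.ofReal lam * ∫⁻ s in Ico 0 t, lrShortfall lam M x k ((t, p) :: h) s := by
  -- During retaliation the action does not affect the future and the opponent uses `aN`, so the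
  -- Nash property settles the comparison.
  by_cases hr : Retaliating x k h t
  · rw [lrShortfall_eq hlam hx]
    gcongr 1
    · refine ENNReal.ofReal_le_ofReal (sub_le_sub_left ?_ _)
      have : lrStrategy x k h t = G.aN := by simp [lrStrategy, hr]
      rw [payoff, hp, this]
      exact G.nash _
    · gcongr 1
      exact (setLIntegral_congr_fun measurableSet_Ico fun s hs =>
        (lrShortfall_cons_of_conform (Or.inl hr) hs).symm).le
  have hxt : lrStrategy x k h t = x t := by simp [lrStrategy, hr]
  by_cases hpx : p = fun _ => x t
  · have := (lrShortfall_conform hlam hx M k h t).ge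
    rw [hxt, ← hpx] at this
    rw [hpx] at this ⊢
    exact this
  have h0 : ∀ s ∈ Ico 0 t, lrStrategy x k h s = x s := fun s hs => by
    have : ¬ Retaliating x k h s := fun h => hr (h.mono hs.2.le)
    simp [lrStrategy, this]
  have hsub : Ico ((1 - k) * t) t ⊆ Ico 0 t :=
    Ico_subset_Ico_left (mul_nonneg (sub_nonneg.2 hk.2.le) ht.1)
  -- A genuine deviation changes the later play only on `[(1 - k) t, t)`, from `x s` to `aN`; the
  -- stage shortfall grows there by `loss (x s)`.
  have hpt : ∀ s ∈ Ico 0 t,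
      ENNReal.ofReal (Real.exp (lam * (t - s))) *
        ENNReal.ofReal (M - G.symPay (lrStrategy x k ((t, p) :: h) s)) =
      ENNReal.ofReal (Real.exp (lam * (t - s))) *
        ENNReal.ofReal (M - G.symPay (lrStrategy x k h s)) +
      (Ico ((1 - k) * t) t).indicator (fun s => ENNReal.ofReal (Real.exp (lam * (t - s))) *
        ENNReal.ofReal (G.loss (x s))) s := by
    intro s hs
    have hsT : s ∈ Icc 0 T := ⟨hs.1, hs.2.le.trans ht.2⟩
    rw [h0 s hs]
    by_cases hks : (1 - k) * t ≤ s
    · have : lrStrategy x k ((t, p) :: h) s = G.aN := by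
        simp [lrStrategy, retaliating_cons_iff_of_not hr, hpx, hks]
      rw [this, indicator_of_mem (show s ∈ Ico ((1 - k) * t) t from ⟨hks, hs.2⟩), ← mul_add,
        ← ENNReal.ofReal_add (sub_nonneg.2 (hM s hsT)) (hL s hsT)]
      congr 2
      simp only [loss, symPay]
      ring
    · have : lrStrategy x k ((t, p) :: h) s = x s := by
        simp [lrStrategy, retaliating_cons_iff_of_not hr, hks]
      rw [this, indicator_of_notMem (fun h => hks h.1), add_zero]
  have hint : ∫⁻ s in Ico 0 t, lrShortfall lam M x k ((t, p) :: h) s =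
      (∫⁻ s in Ico 0 t, ENNReal.ofReal (Real.exp (lam * (t - s))) *
        ENNReal.ofReal (M - G.symPay (lrStrategy x k h s))) +
      ∫⁻ s in Ico ((1 - k) * t) t,
          ENNReal.ofReal (Real.exp (lam * (t - s))) * ENNReal.ofReal (G.loss (x s)) := by
    unfold lrShortfall
    rw [lintegral_renewalValue hlam (measurable_stageShortfall hx M k _),
      setLIntegral_congr_fun measurableSet_Ico hpt, lintegral_add_left]
    · rw [lintegral_indicator measurableSet_Ico, Measure.restrict_restrict measurableSet_Ico,
        inter_eq_left.2 hsub]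
    · exact Measurable.mul (by fun_prop) (measurable_stageShortfall hx M k _)
  rw [hint, mul_add, lrShortfall, renewalValue, hxt, payoff, hp, hxt]
  rw [add_comm (ENNReal.ofReal lam * _), ← add_assoc]
  gcongr 1
  exact hIC t ht _

theorem finalProfile_eq_strategy (σ : Bool → G.Strategy) (h : G.History) (t : ℝ) (l : List ℝ) :
    ∃ h' : G.History, ∃ s ∈ t :: l, finalProfile σ h t l = fun i => σ i h' s := by
  induction l generalizing h t with
  | nil => exact ⟨h, t, by simp, rfl⟩
  | cons s l ih =>
    obtain ⟨h', r, hr, he⟩ := ih ((t, fun i => σ i h t) :: h) s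
    exact ⟨h', r, List.mem_cons_of_mem _ hr, he⟩

theorem ae_finalProfile (lam : ℝ) {T : ℝ} (σ : Bool → G.Strategy) (h : G.History) {t : ℝ}
    (ht : t ∈ Icc 0 T) :
    ∀ᵐ w ∂(arrivalLaw lam t), ∃ h' : G.History, ∃ s ∈ Icc 0 T,
      finalProfile σ h t (List.ofFn w.2) = fun i => σ i h' s := by
  filter_upwards [ae_arrivalLaw_mem lam t] with w hw
  obtain ⟨h', s, hs, he⟩ := finalProfile_eq_strategy σ h t (List.ofFn w.2)
  refine ⟨h', s, ?_, he⟩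
  rcases List.mem_cons.1 hs with rfl | hs
  · exact ht
  · obtain ⟨j, rfl⟩ := List.mem_ofFn.1 hs
    exact ⟨(hw.2 j).1, (hw.2 j).2.le.trans ht.2⟩

/-- The mass is the expectation of the constant `1`, for which `e ^ (lam s)` is a supersolution.
Finiteness is enough: the mass enters both expected payoffs through the same term `M * mass`, which
cancels. -/
theorem isFiniteMeasure_arrivalLaw {lam : ℝ} (hlam : 0 < lam) {G : StageGame} {t : ℝ}
    (ht : 0 ≤ t) : IsFiniteMeasure (arrivalLaw lam t) := by
  refine ⟨?_⟩
  have hσ : ∀ _ : Bool, StageGame.Strategy.IsMeasurable (G := G) fun _ _ => G.aN :=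
    fun _ _ => measurable_const
  have h1 := lintegral_finalProfile hlam.le hσ (F := fun _ => 1) measurable_const [] t
  rw [lintegral_one] at h1
  rw [h1]
  refine ENNReal.mul_lt_top ENNReal.ofReal_lt_top (lt_of_le_of_lt (iSup_le fun N => ?_)
    (ENNReal.ofReal_lt_top (r := Real.exp (lam * t))))
  refine arrivalSum_le (T := t) hσ measurable_const
    (fun _ s => ENNReal.ofReal (Real.exp (lam * s))) (fun h s hn => ?_) N [] t
    ⟨ht, by simp, by simp⟩
  have h2 := lintegral_Ico_exp hlam.ne' hn.1 0
  simp only [sub_zero, mul_zero, Real.exp_zero] at h2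
  rw [h2, ← ENNReal.ofReal_mul hlam.le, mul_div_cancel₀ _ hlam.ne', ← ENNReal.ofReal_one,
    ← ENNReal.ofReal_add zero_le_one, add_sub_cancel]
  exact sub_nonneg.2 (Real.one_le_exp (mul_nonneg hlam.le hn.1))

/-- The one-shot deviation principle for limited retaliation strategies. -/
theorem isSPE_lrStrategy_of_oneShot {lam T M k : ℝ} (hlam : 0 < lam) (hT : 0 ≤ T)
    (hk : k ∈ Ioo (0 : ℝ) 1) {x : ℝ → G.A} (hx : Measurable x)
    (hM : ∀ t ∈ Icc 0 T, ∀ b, G.pay b (x t) ≤ M) (hMN : G.pay G.aN G.aN ≤ M)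
    (hL : ∀ t ∈ Icc 0 T, 0 ≤ G.loss (x t))
    (hIC : ∀ t ∈ Icc 0 T, ∀ b, ENNReal.ofReal (M - G.symPay (x t)) ≤
      ENNReal.ofReal (M - G.pay b (x t)) + ENNReal.ofReal lam *
        ∫⁻ s in Ico ((1 - k) * t) t,
          ENNReal.ofReal (Real.exp (lam * (t - s))) * ENNReal.ofReal (G.loss (x s))) :
    IsSPE lam T (fun _ : Bool => lrStrategy x k) := by
  have hσ : ∀ _ : Bool, (lrStrategy x k).IsMeasurable := fun _ => isMeasurable_lrStrategy hx k
  have hMlr : ∀ h, ∀ t ∈ Icc 0 T, ∀ b, G.pay b (lrStrategy x k h t) ≤ M := by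
    intro h t ht b
    rcases lrStrategy_eq x k h t with h1 | h1 <;> rw [h1]
    · exact (G.nash b).trans hMN
    · exact hM t ht b
  have hNlr : ∀ h, ∀ t ∈ Icc 0 T, G.pay G.aN G.aN ≤ G.symPay (lrStrategy x k h t) := by
    intro h t ht
    rcases lrStrategy_eq x k h t with h1 | h1 <;> rw [h1]
    · exact le_rfl
    · exact sub_nonneg.1 (hL t ht)
  refine ⟨hσ, fun h t hn i => ?_⟩
  have ht : t ∈ Icc 0 T := ⟨hn.1, hn.le⟩
  have := isFiniteMeasure_arrivalLaw hlam (G := G) ht.1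
  have hF : Measurable fun p : G.Profile => ENNReal.ofReal (M - payoff i p) :=
    ((measurable_payoff i).const_sub M).ennreal_ofReal
  have hint : Integrable (realizedPayoff (fun _ : Bool => lrStrategy x k) i h t)
      (arrivalLaw lam t) := by
    refine Integrable.of_mem_Icc (G.pay G.aN G.aN) M
      ((measurable_payoff i).comp (measurable_finalProfile_arrivals hσ h t)).aemeasurable ?_
    filter_upwards [ae_finalProfile lam (fun _ : Bool => lrStrategy x k) h ht] with w hw
    obtain ⟨h', s, hs, he⟩ := hw
    rw [realizedPayoff, he]
    exact ⟨hNlr h' s hs, hMlr h' s hs _⟩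
  refine ⟨hint, fun s' hs' hint' => ?_⟩
  have hσ' : ∀ j, (Function.update (fun _ : Bool => lrStrategy x k) i s' j).IsMeasurable := by
    intro j
    by_cases hj : j = i
    · subst hj; simpa using hs'
    · simpa [hj] using hσ j
  have hopp : ∀ h t, Function.update (fun _ : Bool => lrStrategy x k) i s' (!i) h t =
      lrStrategy x k h t := by
    intro h t
    rw [Function.update_of_ne (by simp)]
  -- As the opponent of `i` follows the LR strategy, `M` dominates the payoff of `i` almost surely,
  -- and integrable payoffs translate into finite `ENNReal` shortfalls.
  have hconv : ∀ σ : Bool → G.Strategy, (∀ j, (σ j).IsMeasurable) →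
      (∀ h t, σ (!i) h t = lrStrategy x k h t) →
      Integrable (realizedPayoff σ i h t) (arrivalLaw lam t) →
      expectedPayoff lam σ i h t = M * (arrivalLaw lam t).real univ -
        (∫⁻ w, ENNReal.ofReal (M - payoff i (finalProfile σ h t (List.ofFn w.2)))
          ∂(arrivalLaw lam t)).toReal ∧
      ∫⁻ w, ENNReal.ofReal (M - payoff i (finalProfile σ h t (List.ofFn w.2)))
          ∂(arrivalLaw lam t) ≠ ⊤ := by
    intro σ hm ho hi
    have hi2 : Integrable (fun w => M - realizedPayoff σ i h t w) (arrivalLaw lam t) :=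
      (integrable_const M).sub hi
    have hnn : 0 ≤ᵐ[arrivalLaw lam t] fun w => M - realizedPayoff σ i h t w := by
      filter_upwards [ae_finalProfile lam σ h ht] with w hw
      obtain ⟨h', s, hs, he⟩ := hw
      rw [realizedPayoff, he, payoff, ho]
      exact sub_nonneg.2 (hMlr h' s hs _)
    have h1 := ofReal_integral_eq_lintegral_ofReal hi2 hnn
    have h2 : ∫ w, M - realizedPayoff σ i h t w ∂(arrivalLaw lam t) =
        M * (arrivalLaw lam t).real univ - expectedPayoff lam σ i h t := by
      rw [integral_sub (integrable_const M) hi, integral_const, smul_eq_mul, mul_comm]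
      rfl
    simp only [realizedPayoff] at h1 hnn h2
    refine ⟨?_, by rw [← h1]; exact ENNReal.ofReal_ne_top⟩
    rw [← h1, ENNReal.toReal_ofReal (integral_nonneg_of_ae hnn), h2]
    ring
  obtain ⟨e1, -⟩ := hconv _ hσ (fun _ _ => rfl) hint
  obtain ⟨e2, f2⟩ := hconv _ hσ' hopp hint'
  rw [e1, e2]
  refine sub_le_sub_left (ENNReal.toReal_mono f2 ?_) _
  rw [lintegral_finalProfile hlam.le hσ hF h t, lintegral_finalProfile hlam.le hσ' hF h t]
  gcongr 1
  -- `lrShortfall` separates the two sums: it is a supersolution for the LR profile and a bounded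
  -- subsolution for the deviating one.
  refine (iSup_le fun N => arrivalSum_le (T := T) hσ hF (lrShortfall lam M x k)
    (fun h t _ => (lrShortfall_conform hlam hx M k h t).le) N h t hn).trans ?_
  refine le_iSup_arrivalSum (T := T) hlam.le hσ' hF (lrShortfall lam M x k) (fun h t hn => ?_)
    (D := (M - G.pay G.aN G.aN) + lam * (Real.exp (lam * T) * (M - G.pay G.aN G.aN) * T))
    ?_ (fun h t hn => ?_) h t hn
  · exact lrShortfall_le_of_deviation hlam hk hx (fun t ht => hM t ht _) hL hIC
      ⟨hn.1, hn.le⟩ (hopp h t)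
  · have := sub_nonneg.2 hMN
    positivity
  · refine renewalValue_le hlam.le (sub_nonneg.2 hMN) hT ⟨hn.1, hn.le⟩ fun s hs => ?_
    exact ENNReal.ofReal_le_ofReal (sub_le_sub_left (hNlr h s ⟨hs.1, hs.2.trans hn.le⟩) _)

end StageGame

/-! ### Incentives within one slot -/

/-- The incentive constraint holds throughout `[κ w, w]` if it holds at the two end points. -/
theorem incentive_of_endpoints {lam κ w t g l₁ l₂ : ℝ} (hκ : κ ∈ Ioo (0 : ℝ) 1)
    (hlam : 0 < lam) (hl₂ : 0 ≤ l₂) (ht : t ∈ Icc (κ * w) w)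
    (hleft : g * Real.exp (-(lam * (κ * w - κ * (κ * w)))) ≤
      l₂ * (1 - Real.exp (-(lam * (κ * w - κ * (κ * w))))))
    (hright : g * Real.exp (-(lam * (w - κ * w))) ≤
      l₁ * (1 - Real.exp (-(lam * (w - κ * w))))) :
    g ≤ l₁ * (Real.exp (lam * (t - κ * w)) - 1) +
      l₂ * (Real.exp (lam * (t - κ * t)) - Real.exp (lam * (t - κ * w))) := by
  set u := κ * w with hu
  -- With `y = e ^ (-(lam t))` this is `y` times the right side minus `g`; the factor `e ^ (lam κ
  -- t)` lost from punishment becomes the concave power `y ^ κ`.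
  have hconc : ConcaveOn ℝ (Ici (0 : ℝ)) fun y =>
      l₂ * y ^ κ + ((-(l₁ + g)) * y + (l₁ - l₂) * Real.exp (-(lam * u))) := by
    have h1 := (Real.concaveOn_rpow hκ.1.le hκ.2.le).smul hl₂
    have h2 : ConcaveOn ℝ (Ici (0 : ℝ)) fun y : ℝ =>
        (-(l₁ + g)) * y + (l₁ - l₂) * Real.exp (-(lam * u)) :=
      ((LinearMap.mul ℝ ℝ (-(l₁ + g))).concaveOn (convex_Ici 0)).add_const _
    exact h1.add h2
  have hrpow : ∀ r : ℝ, Real.exp (-(lam * r)) ^ κ = Real.exp (-(lam * (κ * r))) := fun r => by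
    rw [← Real.exp_mul]; congr 1; ring
  have hmin := hconc.min_le_of_mem_Icc (x := Real.exp (-(lam * w))) (y := Real.exp (-(lam * u)))
    (z := Real.exp (-(lam * t))) (Real.exp_nonneg _) (Real.exp_nonneg _)
    ⟨Real.exp_le_exp.2 (by nlinarith [ht.2]), Real.exp_le_exp.2 (by nlinarith [ht.1])⟩
  simp only [hrpow, ← hu] at hmin
  have e1 : Real.exp (-(lam * u)) =
      Real.exp (-(lam * (u - κ * u))) * Real.exp (-(lam * (κ * u))) := by
    rw [← Real.exp_add]; congr 1; ring
  have e2 : Real.exp (-(lam * w)) = Real.exp (-(lam * (w - u))) * Real.exp (-(lam * u)) := by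
    rw [← Real.exp_add]; congr 1; ring
  have hpos : 0 ≤ min
      (l₂ * Real.exp (-(lam * u)) + (-(l₁ + g) * Real.exp (-(lam * w)) +
        (l₁ - l₂) * Real.exp (-(lam * u))))
      (l₂ * Real.exp (-(lam * (κ * u))) + (-(l₁ + g) * Real.exp (-(lam * u)) +
        (l₁ - l₂) * Real.exp (-(lam * u)))) := by
    -- At `t = w` the terms in `l₂` cancel, at `t = κ w` those in `l₁`.
    refine le_min ?_ ?_
    · have := mul_le_mul_of_nonneg_right hright (Real.exp_nonneg (-(lam * u)))
      rw [e2]; linarith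
    · have := mul_le_mul_of_nonneg_right hleft (Real.exp_nonneg (-(lam * (κ * u))))
      rw [e1]; linarith
  have h3 := mul_le_mul_of_nonneg_right (hpos.trans hmin) (Real.exp_nonneg (lam * t))
  have e3 : Real.exp (-(lam * t)) * Real.exp (lam * t) = 1 := by
    rw [← Real.exp_add]; simp
  have e4 : Real.exp (lam * (t - u)) = Real.exp (-(lam * u)) * Real.exp (lam * t) := by
    rw [← Real.exp_add]; congr 1; ring
  have e5 : Real.exp (lam * (t - κ * t)) = Real.exp (-(lam * (κ * t))) * Real.exp (lam * t) := by
    rw [← Real.exp_add]; congr 1; ring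
  rw [e4, e5]
  linear_combination h3 - (l₁ + g) * e3

/-! ### Monotonicity of gain and loss, and the chain of slots -/

namespace StageGame

variable {G : StageGame}

theorem pay_le_gain_add_symPay (a b : G.A) : G.pay a b ≤ G.gain b + G.symPay b := by
  obtain ⟨c, hc⟩ := G.exists_best_reply b
  have : G.pay a b ≤ sSup (range fun a' => G.pay a' b) :=
    le_csSup ⟨G.pay c b, by rintro _ ⟨a', rfl⟩; exact hc a'⟩ ⟨a, rfl⟩
  simp only [gain, symPay]
  linarith

theorem below_refl (hG : G.Regular) (a : G.A) : G.Below a a := by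
  rcases lt_or_gt_of_ne hG.ne with h | h
  · exact Or.inl ⟨h, le_rfl⟩
  · exact Or.inr ⟨h, le_rfl⟩

theorem below_total (hG : G.Regular) (a b : G.A) : G.Below a b ∨ G.Below b a := by
  rcases lt_or_gt_of_ne hG.ne with h | h <;> rcases le_total a b with h' | h' <;>
    simp [Below, h, h']

theorem Below.trans {a b c : G.A} (h₁ : G.Below a b) (h₂ : G.Below b c) : G.Below a c := by
  rcases h₁ with ⟨h, h₁⟩ | ⟨h, h₁⟩ <;> rcases h₂ with ⟨h', h₂⟩ | ⟨h', h₂⟩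
  · exact Or.inl ⟨h, h₁.trans h₂⟩
  · exact absurd h' h.not_gt
  · exact absurd h' h.not_gt
  · exact Or.inr ⟨h, h₂.trans h₁⟩

theorem gain_mono (hG : G.Regular) {a b : G.A} (ha : G.Below G.aN a) (hab : G.Below a b) :
    G.gain a ≤ G.gain b := by
  have hmid : ∀ a b, G.Below G.aN a → G.Below a b → G.Below b G.aStar → G.gain a ≤ G.gain b := by
    intro a b h1 h2 h3
    rcases eq_or_ne a b with rfl | hne
    · exact le_rfl
    · exact (hG.gain_strict a b h1 h2 h3 hne).le
  rcases below_total hG b G.aStar with hb | hb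
  · exact hmid a b ha hab hb
  rcases below_total hG a G.aStar with h | h
  · exact (hmid a _ ha h (below_refl hG _)).trans (hG.gain_beyond _ b (below_refl hG _) hb)
  · exact hG.gain_beyond a b h hab

theorem symPay_mono (hG : G.Regular) {a b : G.A} (ha : G.Below G.aN a) (hab : G.Below a b)
    (hb : G.PayMonotoneBeyond ∨ G.Below b G.aStar) : G.symPay a ≤ G.symPay b := by
  have hmid : ∀ a b, G.Below G.aN a → G.Below a b → G.Below b G.aStar →
      G.symPay a ≤ G.symPay b := by
    intro a b h1 h2 h3
    rcases eq_or_ne a b with rfl | hne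
    · exact le_rfl
    · exact (hG.symPay_strict a b h1 h2 h3 hne).le
  rcases below_total hG b G.aStar with hb' | hb'
  · exact hmid a b ha hab hb'
  rcases hb with hb | hb
  · rcases below_total hG a G.aStar with h | h
    · exact (hmid a _ ha h (below_refl hG _)).trans (hb _ b (below_refl hG _) hb')
    · exact hb a b h hab
  · exact hmid a b ha hab hb

theorem loss_mono (hG : G.Regular) {a b : G.A} (ha : G.Below G.aN a) (hab : G.Below a b)
    (hb : G.PayMonotoneBeyond ∨ G.Below b G.aStar) : G.loss a ≤ G.loss b :=
  sub_le_sub_right (symPay_mono hG ha hab hb) _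

theorem loss_nonneg (hG : G.Regular) {a : G.A} (ha : G.Below G.aN a)
    (hb : G.PayMonotoneBeyond ∨ G.Below a G.aStar) : 0 ≤ G.loss a :=
  sub_nonneg.2 (symPay_mono hG (below_refl hG _) ha hb)

theorem loss_le_loss_aStar (a : G.A) : G.loss a ≤ G.loss G.aStar :=
  sub_le_sub_right (G.optimal a) _

/-- If each action of a sequence is deterred by the next one, then no action of the sequence can
be too tempting relative to its own loss: otherwise the sequence would stay above it forever, and
the deterrence, which vanishes in the limit, would fail. -/
theorem gain_le_of_chain (hG : G.Regular) {a : ℕ → G.A} {E : ℕ → ℝ}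
    (ha : ∀ n, G.Below G.aN (a n)) (hb : ∀ n, G.PayMonotoneBeyond ∨ G.Below (a n) G.aStar)
    (hE : Antitone E) (hE₀ : Filter.Tendsto E Filter.atTop (nhds 0))
    (hchain : ∀ n, G.gain (a n) ≤ G.loss (a (n + 1)) * E (n + 1)) (m : ℕ) :
    G.gain (a m) ≤ G.loss (a m) * E m := by
  have hEnn : ∀ n, 0 ≤ E n := fun n => hE.le_of_tendsto hE₀ n
  by_contra! hlt
  have hge : ∀ n, m ≤ n → G.Below (a m) (a n) := by
    intro n hn
    induction n, hn using Nat.le_induction with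
    | base => exact below_refl hG _
    | succ n hn ih =>
      -- If `a (n + 1)` fell back below `a m`, its loss and its factor `E` would both be at most
      -- those of `m`, so deterring `a n`, which is at least as tempting as `a m`, would already
      -- deter `a m` by its own loss.
      refine (below_total hG (a m) (a (n + 1))).resolve_right fun h => hlt.not_ge ?_
      calc G.gain (a m) ≤ G.gain (a n) := gain_mono hG (ha m) ih
        _ ≤ G.loss (a (n + 1)) * E (n + 1) := hchain n
        _ ≤ G.loss (a m) * E m :=
          mul_le_mul (loss_mono hG (ha _) h (hb m)) (hE (by omega)) (hEnn _)
            (loss_nonneg hG (ha m) (hb m))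
  have hlim : Filter.Tendsto (fun n => G.loss G.aStar * E (n + 1)) Filter.atTop (nhds 0) := by
    simpa using ((Filter.tendsto_add_atTop_iff_nat 1).2 hE₀).const_mul (G.loss G.aStar)
  have hle : G.gain (a m) ≤ 0 := by
    refine ge_of_tendsto hlim (Filter.eventually_atTop.2 ⟨m, fun n hn => ?_⟩)
    exact (gain_mono hG (ha m) (hge n hn)).trans ((hchain n).trans
      (mul_le_mul_of_nonneg_right (loss_le_loss_aStar _) (hEnn _)))
  exact (hle.trans (mul_nonneg (loss_nonneg hG (ha m) (hb m)) (hEnn m))).not_gt hlt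

theorem IsPiecewisePlan.exists_slot {T k : ℝ} {a : ℕ → G.A} {x : ℝ → G.A} (hT : 0 < T)
    (hk : k ∈ Ioo (0 : ℝ) 1) (h : IsPiecewisePlan T k a x) {t : ℝ} (ht : t ∈ Ioc 0 T) :
    ∃ n : ℕ, t ∈ Icc ((1 - k) ^ (n + 1) * T) ((1 - k) ^ n * T) ∧ x t = a (n + 1) := by
  rcases ht.2.eq_or_lt with rfl | hlt
  · refine ⟨0, ⟨?_, by simp⟩, by simpa using h.initial⟩
    rw [zero_add, pow_one]
    nlinarith [hk.1]
  -- The slot is bounded below by the first power of `1 - k` that brings `T` down to `t`; `t < T`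
  -- excludes the power zero.
  have hex : ∃ n : ℕ, (1 - k) ^ n * T ≤ t := by
    obtain ⟨n, hn⟩ := exists_pow_lt_of_lt_one (div_pos ht.1 hT) (by linarith [hk.1] : 1 - k < 1)
    exact ⟨n, ((lt_div_iff₀ hT).1 hn).le⟩
  classical
  obtain ⟨n, hn⟩ : ∃ n, Nat.find hex = n + 1 := by
    refine Nat.exists_eq_succ_of_ne_zero fun h0 => ?_
    have := Nat.find_spec hex
    rw [h0] at this
    simp only [pow_zero, one_mul] at this
    linarith
  have h1 := Nat.find_spec hex
  have h2 := Nat.find_min hex (m := n) (by omega)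
  rw [hn] at h1
  push Not at h2
  exact ⟨n, ⟨h1, h2.le⟩, h.slot (n + 1) (by omega) t ⟨h1, by simpa using h2⟩⟩

end StageGame

/-! ### Verification of the one-shot constraints -/

theorem one_sub_mul_exp_neg_iff {g l r : ℝ} :
    g * Real.exp (-r) ≤ l * (1 - Real.exp (-r)) ↔ g ≤ l * (Real.exp r - 1) := by
  have h : Real.exp (-r) * Real.exp r = 1 := by rw [← Real.exp_add]; simp
  rw [← mul_le_mul_iff_left₀ (Real.exp_pos r)]
  have e1 : g * Real.exp (-r) * Real.exp r = g := by rw [mul_assoc, h, mul_one]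
  have e2 : l * (1 - Real.exp (-r)) * Real.exp r = l * (Real.exp r - 1) := by
    rw [mul_assoc, sub_mul, h, one_mul]
  rw [e1, e2]

end

/-- The third hypothesis is not needed: it follows from the second one for every slot. -/
theorem theorem2 (G : StageGame) (hG : G.Regular)
    (T lam k : ℝ) (hT : 0 < T) (hlam : 0 < lam) (hk : k ∈ Set.Ioo (0 : ℝ) 1)
    (x : ℝ → G.A) (hx : StageGame.IsCooperativePlan T x)
    (hbeyond : G.PayMonotoneBeyond ∨ ∀ t ∈ Set.Icc 0 T, G.Below (x t) G.aStar)
    (a : ℕ → G.A)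
    (h1 : StageGame.IsPiecewisePlan T k a x)
    (h2 : ∀ n : ℕ, 1 ≤ n →
      G.gain (a n) * Real.exp (-(lam * slotLength T k (n + 1))) ≤
        G.loss (a (n + 1)) * (1 - Real.exp (-(lam * slotLength T k (n + 1)))))
    (h3 : ∃ c : ℕ, 1 ≤ c ∧
      G.gain (a c) * Real.exp (-(lam * slotLength T k c)) ≤
        G.loss (a c) * (1 - Real.exp (-(lam * slotLength T k c)))) :
    StageGame.IsSPE lam T (fun _ : Bool => StageGame.lrStrategy x k) := by
  have hκ0 : 0 < 1 - k := sub_pos.2 hk.2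
  have hκ1 : 1 - k < 1 := by linarith [hk.1]
  have hb : ∀ t ∈ Icc 0 T, G.PayMonotoneBeyond ∨ G.Below (x t) G.aStar := fun t ht =>
    hbeyond.imp_right fun h => h t ht
  have hLx : ∀ t ∈ Icc 0 T, 0 ≤ G.loss (x t) := fun t ht =>
    StageGame.loss_nonneg hG (hx.cooperative t ht) (hb t ht)
  have hslot : ∀ n : ℕ, (1 - k) ^ (n + 1) * T ∈ Icc 0 T ∧
      x ((1 - k) ^ (n + 1) * T) = a (n + 1) := by
    intro n
    refine ⟨⟨by positivity, mul_le_of_le_one_left hT.le (pow_le_one₀ hκ0.le hκ1.le)⟩,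
      h1.slot (n + 1) (by omega) _ ⟨le_rfl, ?_⟩⟩
    rw [Nat.add_sub_cancel]
    exact mul_lt_mul_of_pos_right (pow_lt_pow_right_of_lt_one₀ hκ0 hκ1 (Nat.lt_succ_self n)) hT
  have hcoop : ∀ n, G.Below G.aN (a (n + 1)) := fun n =>
    (hslot n).2 ▸ hx.cooperative _ (hslot n).1
  have hba : ∀ n, G.PayMonotoneBeyond ∨ G.Below (a (n + 1)) G.aStar := fun n =>
    (hslot n).2 ▸ hb _ (hslot n).1
  have hlen : ∀ n, slotLength T k (n + 1) = k * (1 - k) ^ n * T := fun n => by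
    rw [slotLength, Nat.add_sub_cancel]
  have hEanti : Antitone fun n => Real.exp (lam * slotLength T k (n + 1)) - 1 := by
    refine antitone_nat_of_succ_le fun n => sub_le_sub_right (Real.exp_le_exp.2
      (mul_le_mul_of_nonneg_left ?_ hlam.le)) _
    rw [hlen, hlen]
    exact mul_le_mul_of_nonneg_right (mul_le_mul_of_nonneg_left
      (pow_le_pow_of_le_one hκ0.le hκ1.le (Nat.le_succ n)) hk.1.le) hT.le
  have hE0 : Filter.Tendsto (fun n => Real.exp (lam * slotLength T k (n + 1)) - 1)
      Filter.atTop (nhds 0) := by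
    have h := ((((tendsto_pow_atTop_nhds_zero_of_lt_one hκ0.le hκ1).const_mul k).mul_const
      T).const_mul lam)
    have h' := (Real.continuous_exp.tendsto _).comp h
    simp only [mul_zero, zero_mul, Real.exp_zero] at h'
    simpa [hlen, Function.comp_def] using h'.sub_const 1
  have hchain : ∀ n, G.gain (a (n + 1)) ≤
      G.loss (a (n + 1 + 1)) * (Real.exp (lam * slotLength T k (n + 1 + 1)) - 1) := fun n =>
    one_sub_mul_exp_neg_iff.1 (h2 (n + 1) (by omega))
  have hown := StageGame.gain_le_of_chain hG (a := fun n => a (n + 1)) hcoop hba hEanti hE0 hchain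
  have hLs : 0 ≤ G.loss G.aStar := sub_nonneg.2 (G.optimal _)
  have hEle : ∀ n, Real.exp (lam * slotLength T k (n + 1)) - 1 ≤ Real.exp (lam * T) - 1 := by
    intro n
    refine sub_le_sub_right (Real.exp_le_exp.2 (mul_le_mul_of_nonneg_left ?_ hlam.le)) _
    rw [hlen]
    exact mul_le_of_le_one_left hT.le
      (mul_le_one₀ hk.2.le (pow_nonneg hκ0.le n) (pow_le_one₀ hκ0.le hκ1.le))
  have hET : 0 ≤ Real.exp (lam * T) - 1 := sub_nonneg.2 (Real.one_le_exp (by positivity))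
  have hM0 : 0 ≤ G.loss G.aStar * (Real.exp (lam * T) - 1) := mul_nonneg hLs hET
  -- Here `M` is found: by `hown` the gain on any slot is at most its loss times `e ^ (lam τ) - 1`,
  -- where the loss is maximal at `aStar` and the slot length `τ` is at most `T`.
  have hMa : ∀ n b, G.pay b (a (n + 1)) ≤
      G.symPay G.aStar + G.loss G.aStar * (Real.exp (lam * T) - 1) := by
    intro n b
    have e1 := G.pay_le_gain_add_symPay b (a (n + 1))
    have e2 : G.symPay (a (n + 1)) ≤ G.symPay G.aStar := G.optimal _
    have e3 := (hown n).trans (mul_le_mul (StageGame.loss_le_loss_aStar _) (hEle n)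
      (sub_nonneg.2 (Real.one_le_exp (by rw [hlen]; have := hk.1; positivity))) hLs)
    linarith
  have hMN : G.pay G.aN G.aN ≤
      G.symPay G.aStar + G.loss G.aStar * (Real.exp (lam * T) - 1) := by
    have e2 : G.pay G.aN G.aN ≤ G.symPay G.aStar := G.optimal _
    linarith
  have hM : ∀ t ∈ Icc 0 T, ∀ b, G.pay b (x t) ≤
      G.symPay G.aStar + G.loss G.aStar * (Real.exp (lam * T) - 1) := by
    intro t ht b
    rcases ht.1.eq_or_lt with rfl | h0
    · rw [h1.deadline]
      exact (G.nash b).trans hMN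
    · obtain ⟨n, -, hn⟩ := h1.exists_slot hT hk ⟨h0, ht.2⟩
      rw [hn]
      exact hMa n b
  refine StageGame.isSPE_lrStrategy_of_oneShot hlam hT.le hk hx.measurable hM hMN hLx
    fun t ht b => ?_
  -- At the deadline no punishment can follow, and the constraint holds because the plan plays `aN`
  -- there.
  rcases ht.1.eq_or_lt with rfl | h0
  · refine le_add_right (ENNReal.ofReal_le_ofReal (sub_le_sub_left ?_ _))
    rw [h1.deadline]
    exact G.nash b
  obtain ⟨n, hn, hxt⟩ := h1.exists_slot hT hk ⟨h0, ht.2⟩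
  set w := (1 - k) ^ n * T with hw
  have hu : (1 - k) ^ (n + 1) * T = (1 - k) * w := by rw [hw, pow_succ']; ring
  have hu2 : (1 - k) ^ (n + 1 + 1) * T = (1 - k) * ((1 - k) * w) := by
    rw [hw, pow_succ', pow_succ']; ring
  rw [hu] at hn
  have hlen1 : slotLength T k (n + 1) = w - (1 - k) * w := by rw [hlen, hw]; ring
  have hlen2 : slotLength T k (n + 1 + 1) = (1 - k) * w - (1 - k) * ((1 - k) * w) := by
    rw [hlen, hw, pow_succ']; ring
  have hl2 : 0 ≤ G.loss (a (n + 1 + 1)) := StageGame.loss_nonneg hG (hcoop _) (hba _)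
  have hl1 : 0 ≤ G.loss (a (n + 1)) := StageGame.loss_nonneg hG (hcoop _) (hba _)
  have hleft := h2 (n + 1) (by omega)
  have hright := one_sub_mul_exp_neg_iff.2 (hown n)
  rw [hlen2] at hleft
  rw [hlen1] at hright
  have hinc := incentive_of_endpoints ⟨hκ0, hκ1⟩ hlam hl2 hn hleft hright
  have hκt : (1 - k) * t ≤ (1 - k) * w := mul_le_mul_of_nonneg_left hn.2 hκ0.le
  have hκu : (1 - k) * ((1 - k) * w) ≤ (1 - k) * t := mul_le_mul_of_nonneg_left hn.1 hκ0.le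
  have hx1 : ∀ s ∈ Ico ((1 - k) * w) t, x s = a (n + 1) := fun s hs =>
    h1.slot (n + 1) (by omega) s ⟨hu ▸ hs.1, by
      rw [Nat.add_sub_cancel]; exact hs.2.trans_le hn.2⟩
  have hx2 : ∀ s ∈ Ico ((1 - k) * t) ((1 - k) * w), x s = a (n + 1 + 1) := fun s hs =>
    h1.slot (n + 1 + 1) (by omega) s ⟨hu2 ▸ hκu.trans hs.1, by
      rw [Nat.add_sub_cancel, hu]; exact hs.2⟩
  have hconst : ∀ (l : ℝ) (c d : ℝ), c ≤ d → 0 ≤ l → (∀ s ∈ Ico c d, G.loss (x s) = l) →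
      ENNReal.ofReal lam * ∫⁻ s in Ico c d,
        ENNReal.ofReal (Real.exp (lam * (t - s))) * ENNReal.ofReal (G.loss (x s)) =
      ENNReal.ofReal (l * (Real.exp (lam * (t - c)) - Real.exp (lam * (t - d)))) := by
    intro l c d hcd hl hs
    rw [setLIntegral_congr_fun measurableSet_Ico (g := fun s =>
      ENNReal.ofReal (Real.exp (lam * (t - s))) * ENNReal.ofReal l)
      (fun s h => by simp only [hs s h]), lintegral_mul_const _ (by fun_prop), ← mul_assoc,
      lintegral_Ico_exp_sub hlam hcd, mul_comm, ← ENNReal.ofReal_mul hl]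
  -- The window is cut at the slot boundary `(1 - k) w`; the loss is constant on each piece, so the
  -- cost takes the closed form of `hinc`.
  rw [← Ico_union_Ico_eq_Ico hκt hn.1, lintegral_union measurableSet_Ico
    (Ico_disjoint_Ico_same), mul_add,
    hconst _ _ _ hκt hl2 fun s hs => by rw [hx2 s hs],
    hconst _ _ _ hn.1 hl1 fun s hs => by rw [hx1 s hs], sub_self, mul_zero, Real.exp_zero]
  have hexp1 : Real.exp (lam * (t - (1 - k) * w)) ≤ Real.exp (lam * (t - (1 - k) * t)) :=
    Real.exp_le_exp.2 (mul_le_mul_of_nonneg_left (by linarith) hlam.le)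
  have hexp2 : 1 ≤ Real.exp (lam * (t - (1 - k) * w)) :=
    Real.one_le_exp (mul_nonneg hlam.le (sub_nonneg.2 hn.1))
  rw [← ENNReal.ofReal_add (mul_nonneg hl2 (sub_nonneg.2 hexp1))
    (mul_nonneg hl1 (sub_nonneg.2 hexp2)), ← ENNReal.ofReal_add (sub_nonneg.2 (hM t ht b))]
  · refine ENNReal.ofReal_le_ofReal ?_
    have e1 := G.pay_le_gain_add_symPay b (x t)
    rw [hxt] at e1 ⊢
    linarith
  · exact add_nonneg (mul_nonneg hl2 (sub_nonneg.2 hexp1)) (mul_nonneg hl1 (sub_nonneg.2 hexp2))
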